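/- Let $N\ge 1$ be an integer, let $r>N-1$ be real, and for $\Re(z+r)>0$ put $F(z;r)=\Gamma(z)e^{z+r}(z+r)^{-(z-1/2)}$ (principal branch). Let $z_1,\dots,z_{N+1}$ be distinct points of the half plane $\Re(z+r)>0$, none of them a pole of $\Gamma$, and let $c_\infty(r),c_0(r),\dots,c_{N-1}(r)$ solve the linear system $$c_\infty(r)+\sum_{n=0}^{N-1}\frac{c_n(r)}{z_k+n}=F(z_k;r),\qquad k=1,\dots,N+1 .$$ For $\Re(z+r)>0$ set $$\Gamma_N(z;r)=(z+r)^{z-1/2}e^{-(z+r)}\Big[c_\infty(r)+\sum_{n=0}^{N-1}\frac{c_n(r)}{z+n}\Big],$$ so that $\Gamma_N(z_k;r)=\Gamma(z_k)$ for all $k$. Let $\phi(z)=z(z+1)\cdots(z+N-1)$ and $\psi(z)=\prod_{k=1}^{N+1}(z-z_k)$. (i) Suppose that the approximation is also exact at an additional point $\bar z\in\mathbb{C}\cup\{\infty\}$ different from all $z_k$; that is, either $\bar z$ is finite with $\Re(\bar z+r)>0$, is not a pole of $\Gamma$, and $\Gamma_N(\bar z;r)=\Gamma(\bar z)$, or $\bar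 z=\infty$ and $\Gamma_N(z;r)/\Gamma(z)\to1$ as $|z|\to\infty$ in $\Re(z+r)>0$. Then there is a constant $C_N(r)$, independent of $z$, such that for all $z$ with $\Re z>0$ $$\left|1-\frac{\Gamma_N(z;r)}{\Gamma(z)}\right|\le C_N(r)\left|\Big(\frac1z-\frac1{\bar z}\Big)\frac{\psi(z)}{\phi(z)}\right|,$$ where $1/\infty=0$. (ii) With or without such a point $\bar z$, there is a constant $D_N(r)$, independent of $z$, such that $$1-\frac{\Gamma_N(z;r)}{\Gamma(z)}=\Big(1-\frac{c_\infty(r)}{\sqrt{2\pi}}\Big)+\frac{D_N(r)}{z}+O(z^{-2})\qquad\text{as }|z|\to\infty,\ \Re(z+r)>0 .$$ The constants in (i) and (ii), including the implied one, may depend on everything except $z$. -/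

import Mathlib

open Filter Topology Asymptotics
open scoped OnePoint

noncomputable section

namespace GammaApprox

/-- The scaled gamma function `F(s; r) = Γ(s) e^{s+r} / (s+r)^{s-1/2}` (principal branch, for
`Re (s + r) > 0`). -/
def scaledGamma (r : ℝ) (s : ℂ) : ℂ :=
  Complex.Gamma s * Complex.exp (s + r) / (s + r) ^ (s - 1 / 2)

/-- The `(N+1) × (N+1)` matrix whose row `k` is `(1, 1/z_k, 1/(z_k+1), …, 1/(z_k+N-1))`. -/
def poleMatrix {N : ℕ} (z : Fin (N + 1) → ℂ) : Matrix (Fin (N + 1)) (Fin (N + 1)) ℂ :=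
  Matrix.of fun k => Fin.cons 1 fun n : Fin N => 1 / (z k + (n : ℕ))

/-- The pole sum `F_N(s) = c_∞ + ∑_{n=0}^{N-1} c_n / (s+n)`, for the coefficient vector
`c = (c_∞, c_0, …, c_{N-1})`: `c 0` is `c_∞` and `c n.succ` is `c_n`. -/
def poleSum {N : ℕ} (c : Fin (N + 1) → ℂ) (s : ℂ) : ℂ :=
  c 0 + ∑ n : Fin N, c n.succ / (s + (n : ℕ))

/-- The approximation `Γ_N(s; r) = (s+r)^{s-1/2} e^{-(s+r)} F_N(s)`. -/
def gammaN {N : ℕ} (r : ℝ) (c : Fin (N + 1) → ℂ) (s : ℂ) : ℂ :=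
  (s + r) ^ (s - 1 / 2) * Complex.exp (-(s + r)) * poleSum c s

/-- The relative error `1 - Γ_N(s; r) / Γ(s)`. -/
def relError {N : ℕ} (r : ℝ) (c : Fin (N + 1) → ℂ) (s : ℂ) : ℂ :=
  1 - gammaN r c s / Complex.Gamma s

/-- `φ(s) = s (s+1) ⋯ (s+N-1)`. -/
def phi (N : ℕ) (s : ℂ) : ℂ :=
  ∏ n ∈ Finset.range N, (s + (n : ℕ))

/-- `ψ(s) = ∏_k (s - z_k)`. -/
def psi {N : ℕ} (z : Fin (N + 1) → ℂ) (s : ℂ) : ℂ :=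
  ∏ k, (s - z k)

/-- The filter `|s| → ∞` within the half plane `Re (s + r) > 0`. -/
def atInfinity (r : ℝ) : Filter ℂ :=
  Bornology.cobounded ℂ ⊓ 𝓟 {s : ℂ | 0 < (s + r).re}

/-- `1 / w` for `w` in `ℂ ∪ {∞}`, with `1 / ∞ = 0`. -/
def recip (w : OnePoint ℂ) : ℂ :=
  w.elim 0 fun s => 1 / s

/-- The approximation is exact at a point `w` of `ℂ ∪ {∞}`. For finite `w`: `w` lies in the
half plane where the approximation is defined, is not a pole of `Γ`, and `Γ_N(w; r) = Γ(w)`.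
For `w = ∞`: the relative error tends to `0` at infinity. -/
def IsExactAt {N : ℕ} (r : ℝ) (c : Fin (N + 1) → ℂ) (w : OnePoint ℂ) : Prop :=
  w.elim (Tendsto (relError r c) (atInfinity r) (𝓝 0)) fun s =>
    0 < (s + r).re ∧ (∀ n : ℕ, s ≠ -(n : ℂ)) ∧ gammaN r c s = Complex.Gamma s

end GammaApprox

end

noncomputable section

namespace GammaApprox

/-! Write F for `scaledGamma`, F_N for `poleSum` and κ for `stirlingCoeff`; the relative error is 1
- F_N/F. Everything asymptotic comes from F(s)/√(2π) = 1 + κ/(s+r) + O(|s+r|⁻²), uniformly in the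
half plane (`exists_norm_scaledGamma_sub_le`). With u = s + r, the equation Γ(s+1) = sΓ(s) gives
F(s)/F(s+1) = exp(κ(1/u - 1/(u+1)) + O(|u|⁻³)). Over s, s+1, … the main terms telescope, the cubic
errors sum to O(|u|⁻²), and F(s+n) → √(2π) by Euler's limit for Γ and Stirling's for n!. Dividing
the expansions of F_N and F gives (ii).

For (i), put w = 1/z̄ and let H = sφ(1 - Γ_N/Γ), which is analytic on Re(s+r) > 0 and vanishes at
the nodes and at a finite z̄. Near each point of the closed right half plane H = O((1 - ws)ψ), since
the right side has only simple zeros and H vanishes there. The same holds at infinity, because the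
error is bounded and sφ and ψ both have degree N + 1. Compactness yields one constant, and dividing
by sφ gives the claim. -/

/-! ### One step of the recurrence for F. -/

/-- The logarithm of `F(s; r) / F(s + 1; r)` as a function of `x = 1 / (s + r)`. -/
def logRatio (r : ℝ) (x : ℂ) : ℂ :=
  -Complex.log (1 + -(r * x)) - 1 + (1 / x + 1 / 2 - r) * Complex.log (1 + x)

/-- The coefficient of `1 / (s + r)` in the expansion of `F(s; r) / √(2π)` at infinity. -/
def stirlingCoeff (r : ℝ) : ℂ := r ^ 2 / 2 + r / 2 + 1 / 12

/-- The constant and linear Taylor terms cancel, and κ is the coefficient of x². Comparing with x -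
x/(1+x) = x² - x³/(1+x) rather than x² prepares the telescoping: for x = 1/u it is 1/u - 1/(u+1). -/
lemma logRatio_sub_isBigO (r : ℝ) :
    (fun x : ℂ => logRatio r x - stirlingCoeff r * (x - x / (1 + x))) =O[𝓝[≠] 0]
      fun x : ℂ => x ^ 3 := by
  -- `logTaylor 4` has degree 3; this extra order is lost on multiplying by 1/x.
  have h1 : (fun x : ℂ => Complex.log (1 + x) - Complex.logTaylor 4 x) =O[𝓝[≠] 0]
      fun x : ℂ => x ^ 4 :=
    (Complex.log_sub_logTaylor_isBigO 3).mono nhdsWithin_le_nhds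
  have h2 : (fun x : ℂ => Complex.log (1 + -(r * x)) - Complex.logTaylor 3 (-(r * x)))
      =O[𝓝[≠] 0] fun x : ℂ => x ^ 3 := by
    have ht : Tendsto (fun x : ℂ => -((r : ℂ) * x)) (𝓝[≠] 0) (𝓝 0) := by
      have : Continuous fun x : ℂ => -((r : ℂ) * x) := by fun_prop
      simpa using (this.tendsto 0).mono_left nhdsWithin_le_nhds
    refine ((Complex.log_sub_logTaylor_isBigO 2).comp_tendsto ht).trans ?_
    refine IsBigO.of_bound (|r| ^ 3) (Eventually.of_forall fun x => ?_)
    simp [mul_pow]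
  have h3 : (fun x : ℂ => (Complex.log (1 + x) - Complex.logTaylor 4 x) * (1 / x))
      =O[𝓝[≠] 0] fun x : ℂ => x ^ 3 := by
    refine (h1.mul (isBigO_refl (fun x : ℂ => 1 / x) _)).congr' EventuallyEq.rfl ?_
    filter_upwards [self_mem_nhdsWithin] with x hx
    have : x ≠ 0 := hx
    field_simp
  have h4 : (fun x : ℂ => x ^ 4) =O[𝓝[≠] 0] fun x : ℂ => x ^ 3 :=
    by
    have h0 : Tendsto (fun x : ℂ => x) (𝓝[≠] 0) (𝓝 0) := nhdsWithin_le_nhds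
    exact ((isBigO_refl (fun x : ℂ => x ^ 3) (𝓝[≠] 0)).mul (h0.isBigO_one ℂ)).congr
      (fun x => (pow_succ x 3).symm) fun x => mul_one _
  have h5 : (fun x : ℂ => stirlingCoeff r * (x ^ 3 * (1 + x)⁻¹)) =O[𝓝[≠] 0]
      fun x : ℂ => x ^ 3 := by
    refine IsBigO.const_mul_left ?_ _
    have hc : Tendsto (fun x : ℂ => (1 + x)⁻¹) (𝓝[≠] 0) (𝓝 1) := by
      have : ContinuousAt (fun x : ℂ => (1 + x)⁻¹) 0 := by
        refine ContinuousAt.inv₀ (by fun_prop) (by simp)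
      simpa using this.tendsto.mono_left nhdsWithin_le_nhds
    simpa using (isBigO_refl (fun x : ℂ => x ^ 3) (𝓝[≠] 0)).mul (hc.isBigO_one ℂ)
  refine ((((h2.neg_left).add h3).add ((h1.trans h4).const_mul_left (1 / 2 - r))).add
    (((isBigO_refl (fun x : ℂ => x ^ 3) _).const_mul_left ((1 / 2 - r) / 3)).add h5)).congr' ?_
    EventuallyEq.rfl
  have hne : ∀ᶠ x : ℂ in 𝓝[≠] 0, 1 + x ≠ 0 := by
    have : ContinuousAt (fun x : ℂ => 1 + x) 0 := by fun_prop
    exact (this.eventually_ne (by simp)).filter_mono nhdsWithin_le_nhds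
  filter_upwards [self_mem_nhdsWithin, hne] with x hx hx1
  have hx0 : x ≠ 0 := hx
  simp only [logRatio, stirlingCoeff, Complex.logTaylor_succ, Complex.logTaylor_zero]
  simp only [Pi.add_apply]
  generalize Complex.log (1 + x) = a
  generalize Complex.log (1 + -(r * x)) = b
  field_simp
  push_cast
  ring

lemma exists_logRatio_bound (r : ℝ) :
    ∃ A R : ℝ, 0 ≤ A ∧ ∀ u : ℂ, R ≤ ‖u‖ → 0 < u.re →
      ‖logRatio r (1 / u) - stirlingCoeff r * (1 / u - 1 / (u + 1))‖ ≤ A / ‖u‖ ^ 3 := by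
  obtain ⟨A, hA, h⟩ := (logRatio_sub_isBigO r).exists_pos
  have h' := tendsto_inv₀_cobounded'.eventually (h.bound)
  obtain ⟨R, -, hR⟩ := (hasBasis_cobounded_norm (E := ℂ)).eventually_iff.1 h'
  refine ⟨A, R, hA.le, fun u hu hre => ?_⟩
  have hu0 : u ≠ 0 := by rintro rfl; simp at hre
  have hu1 : u + 1 ≠ 0 := by
    intro h0
    have := congrArg Complex.re h0
    simp at this; linarith
  have h1u : 1 + u⁻¹ ≠ 0 := by
    intro h0; apply hu1; field_simp at h0; simpa using h0
  have := hR hu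
  have e : u⁻¹ / (1 + u⁻¹) = 1 / (u + 1) := by field_simp
  have e2 : u⁻¹ - u⁻¹ / (1 + u⁻¹) = 1 / u - 1 / (u + 1) := by rw [e, one_div u]
  rw [e2, ← one_div, norm_pow, norm_div, norm_one] at this
  simpa [div_eq_mul_inv] using this

/-- Both arguments lie in (-π/2, π/2), so their sum stays in the principal range. -/
lemma log_add_one {u : ℂ} (hu : 0 < u.re) :
    Complex.log (u + 1) = Complex.log u + Complex.log (1 + 1 / u) := by
  have hu0 : u ≠ 0 := by rintro rfl; simp at hu
  have h1 : 0 < (1 + 1 / u).re := by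
    have : 0 < (1 / u).re := by
      rw [one_div, Complex.inv_re]
      exact div_pos hu (Complex.normSq_pos.2 hu0)
    simp only [Complex.add_re, Complex.one_re]; linarith
  have h10 : 1 + 1 / u ≠ 0 := by intro h; rw [h] at h1; simp at h1
  have ha := Complex.abs_arg_lt_pi_div_two_iff.2 (Or.inl hu)
  have hb := Complex.abs_arg_lt_pi_div_two_iff.2 (Or.inl h1)
  rw [← (Complex.log_mul_eq_add_log_iff hu0 h10).2]
  · congr 1; field_simp
  · rw [abs_lt] at ha hb
    constructor <;> linarith [ha.1, ha.2, hb.1, hb.2]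

lemma scaledGamma_eq_exp_mul (r : ℝ) {s : ℂ} (hs : 0 < (s + r).re) (hs0 : s ≠ 0) :
    scaledGamma r s = Complex.exp (logRatio r (1 / (s + r))) * scaledGamma r (s + 1) := by
  obtain ⟨u, rfl⟩ : ∃ u, s = u - r := ⟨s + r, by ring⟩
  simp only [sub_add_cancel] at hs ⊢
  have hu0 : u ≠ 0 := by rintro rfl; simp at hs
  have hu1 : u + 1 ≠ 0 := by
    intro h0
    have := congrArg Complex.re h0
    simp at this; linarith
  have e0 : (1 : ℂ) + -(r * (1 / u)) = (u - r) / u := by field_simp; ring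
  have hq : (u - r) / u ≠ 0 := div_ne_zero hs0 hu0
  have e1 : u - (r : ℂ) + 1 + r = u + 1 := by ring
  unfold scaledGamma logRatio
  rw [Complex.Gamma_add_one _ hs0, sub_add_cancel, e1, e0,
    Complex.cpow_def_of_ne_zero hu0, Complex.cpow_def_of_ne_zero hu1, log_add_one hs]
  have e2 : Complex.exp (-Complex.log ((u - r) / u)) = u / (u - r) := by
    rw [Complex.exp_neg, Complex.exp_log hq, inv_div]
  rw [sub_eq_add_neg (-Complex.log _), add_assoc, Complex.exp_add, e2]
  rw [div_eq_mul_inv _ (Complex.exp _), div_eq_mul_inv _ (Complex.exp _), ← Complex.exp_neg,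
    ← Complex.exp_neg, one_div_one_div]
  have e3 : ∀ a b d : ℂ, u / (u - r) * a * ((u - r) * Complex.Gamma (u - r) * b * d) =
      Complex.Gamma (u - r) * (Complex.exp (Complex.log u) * a * b * d) := by
    intro a b d
    rw [Complex.exp_log hu0]
    field_simp
  rw [e3, mul_assoc (Complex.Gamma _)]
  congr 1
  simp only [← Complex.exp_add]
  congr 1
  ring

/-! ### The limit of F along s + n. -/

lemma stirlingSeq_mul_sqrt_two {n : ℕ} (hn : n ≠ 0) :
    Stirling.stirlingSeq n * √2 =
      (n.factorial : ℝ) * Real.exp (n - (n + 1 / 2) * Real.log n) := by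
  have hn' : (0 : ℝ) < n := by positivity
  have e1 : √(2 * n : ℝ) = √2 * Real.exp (Real.log n / 2) := by
    rw [Real.sqrt_mul (by norm_num), Real.exp_half, Real.exp_log hn']
  have e2 : ((n : ℝ) / Real.exp 1) ^ n = Real.exp (n * Real.log n - n) := by
    conv_lhs => rw [← Real.exp_log hn', ← Real.exp_sub, ← Real.exp_nat_mul]
    congr 1; ring
  have e3 : Real.exp (n - (n + 1 / 2) * Real.log n) =
      (Real.exp (Real.log n / 2) * Real.exp (n * Real.log n - n))⁻¹ := by
    rw [← Real.exp_add, ← Real.exp_neg]; congr 1; ring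
  rw [Stirling.stirlingSeq, e1, e2, e3]
  field_simp

/-- The shift is n + 1 so that the product of s + j over j ≤ n is exactly the denominator of
`GammaSeq s n`; n! goes into `stirlingSeq`, and the remaining exponential tends to 1. -/
lemma scaledGamma_add_succ (r : ℝ) {s : ℂ} (hre : 0 < (s + r).re)
    (hpole : ∀ n : ℕ, s ≠ -(n : ℂ)) {n : ℕ} (hn : n ≠ 0) :
    scaledGamma r (s + (n + 1 : ℕ)) =
      Complex.Gamma s / Complex.GammaSeq s n * ((Stirling.stirlingSeq n * √2 : ℝ) : ℂ) *
        Complex.exp ((s + 1 + r) - (n * Complex.log (1 + (s + 1 + r) / n) +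
          (s + 1 / 2) * Complex.log (1 + (s + 1 + r) / n))) := by
  have hn' : (0 : ℝ) < n := by positivity
  have hn0 : (n : ℂ) ≠ 0 := by exact_mod_cast hn
  have hG := Complex.Gamma_ne_zero hpole
  have hprod : ∏ j ∈ Finset.range (n + 1), (s + (j : ℂ)) ≠ 0 :=
    Finset.prod_ne_zero_iff.2 fun j _ h => hpole j (eq_neg_of_add_eq_zero_left h)
  have h1 : Complex.Gamma (s + (n + 1 : ℕ)) =
      Complex.Gamma s * ∏ j ∈ Finset.range (n + 1), (s + (j : ℂ)) := by
    have hasc : (ascPochhammer ℂ (n + 1)).eval s = ∏ j ∈ Finset.range (n + 1), (s + (j : ℂ)) := by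
      induction n + 1 with
      | zero => simp
      | succ m ih => rw [ascPochhammer_succ_eval, ih, Finset.prod_range_succ]
    rw [← hasc, ← Complex.Gamma_add_nat_div_Gamma_eq s hpole]
    field_simp
  have hre2 : 0 < (s + (n + 1 : ℕ) + r).re := by
    have : s + (n + 1 : ℕ) + r = (s + r) + ((n + 1 : ℝ) : ℂ) := by push_cast; ring
    rw [this, Complex.add_re, Complex.ofReal_re]
    linarith
  have hu0 : s + (n + 1 : ℕ) + r ≠ 0 := by intro h; rw [h] at hre2; simp at hre2
  have hmul : s + (n + 1 : ℕ) + r = ((n : ℝ) : ℂ) * (1 + (s + 1 + r) / n) := by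
    push_cast; field_simp; ring
  have h10 : 1 + (s + 1 + r) / n ≠ 0 := by
    intro h; rw [hmul, h] at hu0; simp at hu0
  have hlog : Complex.log (s + (n + 1 : ℕ) + r) =
      (Real.log n : ℂ) + Complex.log (1 + (s + 1 + r) / n) := by
    rw [hmul, Complex.log_ofReal_mul hn' h10]
  have hfac : (n.factorial : ℂ) ≠ 0 := by exact_mod_cast n.factorial_ne_zero
  rw [stirlingSeq_mul_sqrt_two hn, scaledGamma, h1, Complex.cpow_def_of_ne_zero hu0, hlog,
    Complex.GammaSeq, Complex.cpow_def_of_ne_zero hn0, ← Complex.natCast_log]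
  generalize Complex.log (1 + (s + 1 + r) / n) = M
  generalize Real.log n = L
  generalize ∏ j ∈ Finset.range (n + 1), (s + (j : ℂ)) = Q at *
  push_cast
  have e : ∀ E : ℂ, Complex.Gamma s / (Complex.exp (L * s) * n.factorial / Q) *
      (n.factorial * Complex.exp (n - (n + 1 / 2) * L)) * E =
      Complex.Gamma s * Q * (Complex.exp (-(L * s)) * Complex.exp (n - (n + 1 / 2) * L) * E) := by
    intro E
    rw [Complex.exp_neg]
    field_simp
  rw [e, mul_div_assoc]
  congr 1
  rw [← Complex.exp_sub, ← Complex.exp_add, ← Complex.exp_add]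
  congr 1
  ring

lemma tendsto_scaledGamma_add_natCast (r : ℝ) {s : ℂ} (hre : 0 < (s + r).re)
    (hpole : ∀ n : ℕ, s ≠ -(n : ℂ)) :
    Tendsto (fun n : ℕ => scaledGamma r (s + n)) atTop (𝓝 (√(2 * Real.pi) : ℝ)) := by
  rw [← tendsto_add_atTop_iff_nat 1]
  have hG := Complex.Gamma_ne_zero hpole
  have h1 : Tendsto (fun n : ℕ => Complex.Gamma s / Complex.GammaSeq s n) atTop (𝓝 1) := by
    rw [← div_self hG]
    exact (tendsto_const_nhds (x := Complex.Gamma s)).div (Complex.GammaSeq_tendsto_Gamma s) hG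
  have h2 : Tendsto (fun n : ℕ => ((Stirling.stirlingSeq n * √2 : ℝ) : ℂ)) atTop
      (𝓝 (√(2 * Real.pi) : ℝ)) := by
    have := Stirling.tendsto_stirlingSeq_sqrt_pi.mul_const √2
    rw [← Real.sqrt_mul Real.pi_pos.le, mul_comm Real.pi] at this
    exact (Complex.continuous_ofReal.tendsto _).comp this
  have hdiv : Tendsto (fun n : ℕ => (s + 1 + r) / (n : ℂ)) atTop (𝓝 0) :=
    tendsto_const_div_atTop_nhds_zero_nat _
  have h3 : Tendsto (fun n : ℕ => (n : ℂ) * Complex.log (1 + (s + 1 + r) / n)) atTop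
      (𝓝 (s + 1 + r)) := by
    refine Complex.tendsto_nat_mul_log_one_add_of_tendsto (tendsto_nhds_of_eventually_eq ?_)
    filter_upwards [eventually_ne_atTop 0] with n hn
    have : (n : ℂ) ≠ 0 := by exact_mod_cast hn
    field_simp
  have h4 : Tendsto (fun n : ℕ => Complex.log (1 + (s + 1 + r) / n)) atTop (𝓝 0) := by
    have hc : ContinuousAt (fun x : ℂ => Complex.log (1 + x)) 0 :=
      ContinuousAt.clog (by fun_prop) (by simp)
    simpa [Function.comp_def] using hc.tendsto.comp hdiv
  have h5 := (Complex.continuous_exp.tendsto _).comp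
    ((tendsto_const_nhds (x := s + 1 + r)).sub (h3.add (h4.const_mul (s + 1 / 2))))
  have h6 := (h1.mul h2).mul h5
  simp only [mul_zero, add_zero, sub_self, Complex.exp_zero, mul_one, one_mul] at h6
  refine h6.congr' ?_
  filter_upwards [eventually_ne_atTop 0] with n hn
  rw [scaledGamma_add_succ r hre hpole hn]
  rfl

/-! ### Summing the errors, and Stirling's formula in the half plane. -/

lemma one_div_cube_le {x : ℝ} (hx : 1 ≤ x) :
    1 / x ^ 3 ≤ 2 * (1 / x ^ 2 - 1 / (x + 1) ^ 2) := by
  have h : 2 * (1 / x ^ 2 - 1 / (x + 1) ^ 2) = 2 * (2 * x + 1) / (x ^ 2 * (x + 1) ^ 2) := by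
    field_simp; ring
  rw [h, div_le_div_iff₀ (by positivity) (by positivity)]
  nlinarith [pow_pos (show 0 < x by linarith) 2, pow_pos (show 0 < x by linarith) 3,
    pow_pos (show 0 < x by linarith) 4, mul_nonneg (pow_pos (show 0 < x by linarith) 3).le
      (sub_nonneg.2 hx)]

lemma norm_le_norm_add_natCast {u : ℂ} (hu : 0 < u.re) (k : ℕ) : ‖u‖ ≤ ‖u + k‖ := by
  rw [Complex.norm_def, Complex.norm_def]
  apply Real.sqrt_le_sqrt
  simp only [Complex.normSq_apply, Complex.add_re, Complex.natCast_re, Complex.add_im,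
    Complex.natCast_im, add_zero]
  nlinarith [(Nat.cast_nonneg k : (0 : ℝ) ≤ k)]

/-- Averages the two lower bounds ‖u‖ and k. -/
lemma norm_add_natCast_ge {u : ℂ} (hu : 0 < u.re) (k : ℕ) : (‖u‖ + k) / 2 ≤ ‖u + k‖ := by
  have h1 := norm_le_norm_add_natCast hu k
  have h2 : (k : ℝ) ≤ ‖u + k‖ := by
    refine le_trans ?_ (Complex.re_le_norm _)
    simp; linarith
  linarith

lemma sum_one_div_norm_cube_le {u : ℂ} (hu : 0 < u.re) (h1 : 1 ≤ ‖u‖) (n : ℕ) :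
    ∑ k ∈ Finset.range n, 1 / ‖u + k‖ ^ 3 ≤ 16 / ‖u‖ ^ 2 := by
  -- 16 = 2³ · 2: the halved norm, cubed, and the factor in `one_div_cube_le`.
  have h : ∀ k ∈ Finset.range n, 1 / ‖u + k‖ ^ 3 ≤
      16 * (1 / (‖u‖ + k) ^ 2 - 1 / (‖u‖ + (k + 1 : ℕ)) ^ 2) := by
    intro k _
    have hk : (0 : ℝ) ≤ k := Nat.cast_nonneg k
    have h2 := one_div_cube_le (x := ‖u‖ + k) (by linarith)
    have h3 : 1 / ‖u + k‖ ^ 3 ≤ 1 / ((‖u‖ + k) / 2) ^ 3 := by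
      have := norm_add_natCast_ge hu k
      gcongr
    refine h3.trans ?_
    have e : 1 / ((‖u‖ + k) / 2) ^ 3 = 8 * (1 / (‖u‖ + k) ^ 3) := by field_simp; norm_num
    push_cast
    rw [e, ← add_assoc]
    linarith
  refine (Finset.sum_le_sum h).trans ?_
  rw [← Finset.mul_sum, Finset.sum_range_sub' fun k : ℕ => 1 / (‖u‖ + k) ^ 2]
  have : 0 ≤ 1 / (‖u‖ + n) ^ 2 := by positivity
  simp only [Nat.cast_zero, add_zero]
  rw [show (16 : ℝ) / ‖u‖ ^ 2 = 16 * (1 / ‖u‖ ^ 2) by ring]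
  linarith

lemma scaledGamma_eq_exp_sum_mul (r : ℝ) {s : ℂ} (hs : 0 < (s + r).re)
    (hs0 : ∀ k : ℕ, s + k ≠ 0) (n : ℕ) :
    scaledGamma r s = Complex.exp (∑ k ∈ Finset.range n, logRatio r (1 / (s + r + k))) *
      scaledGamma r (s + n) := by
  induction n with
  | zero => simp
  | succ n ih =>
    have hn : 0 < (s + n + r).re := by
      rw [add_right_comm, Complex.add_re, Complex.natCast_re]
      positivity
    rw [ih, scaledGamma_eq_exp_mul r hn (hs0 n), Finset.sum_range_succ, Complex.exp_add,
      add_right_comm s (n : ℂ) (r : ℂ)]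
    push_cast
    ring_nf

/-- Stirling's formula with one correction term, in the half plane `Re (s + r) > 0`. -/
lemma exists_norm_scaledGamma_sub_le (r : ℝ) :
    ∃ B R : ℝ, ∀ s : ℂ, R ≤ ‖s + r‖ → 0 < (s + r).re →
      ‖scaledGamma r s / (√(2 * Real.pi) : ℝ) - (1 + stirlingCoeff r / (s + r))‖ ≤
        B / ‖s + r‖ ^ 2 := by
  obtain ⟨A, R₀, hA, h⟩ := exists_logRatio_bound r
  set K := ‖stirlingCoeff r‖
  have hK : 0 ≤ K := norm_nonneg _
  -- ‖s + r‖ > |r| keeps every s + k away from 0, and ‖s + r‖ ≥ K + 16A makes the exponent `v` below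
  -- at most 1 in norm. In the constant, the square bounds exp v - 1 - v and 16A bounds v - κ/u.
  refine ⟨(K + 16 * A) ^ 2 + 16 * A, max (max R₀ 1) (max (|r| + 1) (K + 16 * A)), ?_⟩
  intro s hR hre
  simp only [max_le_iff] at hR
  obtain ⟨⟨hR0, hR1⟩, hRr, hRK⟩ := hR
  set u : ℂ := s + r with hu
  have hu_pos : 0 < ‖u‖ := by linarith
  have hnorm : ∀ k : ℕ, ‖u‖ ≤ ‖u + k‖ := norm_le_norm_add_natCast hre
  have hre' : ∀ k : ℕ, 0 < (u + k).re := by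
    intro k; rw [Complex.add_re, Complex.natCast_re]; positivity
  have hs0 : ∀ k : ℕ, s + k ≠ 0 := by
    intro k hk
    have h1 : u + k = r := by rw [hu, add_right_comm, hk, zero_add]
    have h2 := hnorm k
    rw [h1, Complex.norm_real, Real.norm_eq_abs] at h2
    linarith
  have hpole : ∀ n : ℕ, s ≠ -(n : ℂ) := fun n hn => hs0 n (by rw [hn]; ring)
  have hlim := tendsto_scaledGamma_add_natCast r hre hpole
  have hpi : ((√(2 * Real.pi) : ℝ) : ℂ) ≠ 0 := by
    have : 0 < √(2 * Real.pi) := by positivity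
    exact_mod_cast this.ne'
  set S : ℕ → ℂ := fun n => ∑ k ∈ Finset.range n, logRatio r (1 / (u + k))
  have herr : ∀ n, ‖S n - stirlingCoeff r * (1 / u - 1 / (u + n))‖ ≤ 16 * A / ‖u‖ ^ 2 := by
    intro n
    have e : S n - stirlingCoeff r * (1 / u - 1 / (u + n)) = ∑ k ∈ Finset.range n,
        (logRatio r (1 / (u + k)) - stirlingCoeff r * (1 / (u + k) - 1 / (u + k + 1))) := by
      have ht := Finset.sum_range_sub' (fun k : ℕ => 1 / (u + k)) n
      simp only [Nat.cast_zero, add_zero, Nat.cast_add, Nat.cast_one, ← add_assoc] at ht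
      rw [Finset.sum_sub_distrib, ← Finset.mul_sum, ht]
    rw [e]
    calc _ ≤ ∑ k ∈ Finset.range n, A * (1 / ‖u + k‖ ^ 3) := by
          refine norm_sum_le_of_le _ fun k _ => ?_
          rw [mul_one_div]
          exact h _ (hR0.trans (hnorm k)) (hre' k)
      _ ≤ A * (16 / ‖u‖ ^ 2) := by
          rw [← Finset.mul_sum]
          exact mul_le_mul_of_nonneg_left (sum_one_div_norm_cube_le hre hR1 n) hA
      _ = 16 * A / ‖u‖ ^ 2 := by ring
  have hbound : ∀ n, ‖Complex.exp (S n + stirlingCoeff r / (u + n)) -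
      (1 + stirlingCoeff r / u)‖ ≤ ((K + 16 * A) ^ 2 + 16 * A) / ‖u‖ ^ 2 := by
    intro n
    -- Adding κ/(u+n), which tends to 0, makes the main term κ/u independent of n, so the bound
    -- passes to the limit.
    set v := S n + stirlingCoeff r / (u + n)
    have hv : v - stirlingCoeff r / u = S n - stirlingCoeff r * (1 / u - 1 / (u + n)) := by
      simp only [v]; ring
    have h1 : ‖v - stirlingCoeff r / u‖ ≤ 16 * A / ‖u‖ ^ 2 := hv ▸ herr n
    have h2 : 16 * A / ‖u‖ ^ 2 ≤ 16 * A / ‖u‖ := by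
      gcongr
      nlinarith
    have h3 : ‖v‖ ≤ (K + 16 * A) / ‖u‖ := by
      have := norm_add_le (stirlingCoeff r / u) (v - stirlingCoeff r / u)
      rw [add_sub_cancel, norm_div] at this
      rw [add_div]
      linarith
    have h4 : ‖v‖ ≤ 1 := h3.trans ((div_le_one hu_pos).2 hRK)
    have h5 := Complex.norm_exp_sub_one_sub_id_le h4
    have h6 : ‖v‖ ^ 2 ≤ ((K + 16 * A) / ‖u‖) ^ 2 := by gcongr
    have h7 : Complex.exp v - (1 + stirlingCoeff r / u) =
      (Complex.exp v - 1 - v) + (v - stirlingCoeff r / u) := by ring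
    rw [h7, add_div, ← div_pow]
    exact (norm_add_le _ _).trans (by linarith)
  have hne : ∀ᶠ n : ℕ in atTop, scaledGamma r (s + n) ≠ 0 := hlim.eventually_ne hpi
  have hinv : Tendsto (fun n : ℕ => stirlingCoeff r / (u + n)) atTop (𝓝 0) := by
    have h1 : Tendsto (fun n : ℕ => u + (n : ℂ)) atTop (Bornology.cobounded ℂ) := by
      refine tendsto_norm_atTop_iff_cobounded.1 (tendsto_atTop_mono (fun n => ?_)
        (tendsto_natCast_atTop_atTop (R := ℝ)))
      refine le_trans ?_ (Complex.re_le_norm _)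
      rw [Complex.add_re, Complex.natCast_re]
      linarith
    simpa [div_eq_mul_inv, Function.comp_def] using
      (tendsto_inv₀_cobounded.comp h1).const_mul (stirlingCoeff r)
  have hexp : Tendsto (fun n : ℕ => Complex.exp (S n + stirlingCoeff r / (u + n))) atTop
      (𝓝 (scaledGamma r s / (√(2 * Real.pi) : ℝ))) := by
    have h1 := (((Complex.continuous_exp.tendsto _).comp hinv).const_mul (scaledGamma r s)).div
      hlim hpi
    rw [Complex.exp_zero, mul_one] at h1
    refine h1.congr' ?_
    filter_upwards [hne] with n hn
    have := scaledGamma_eq_exp_sum_mul r hre hs0 n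
    simp only [Pi.div_apply, Function.comp_apply]
    rw [Complex.exp_add, div_eq_iff hn, this]
    ring
  exact le_of_tendsto ((hexp.sub_const _).norm) (Eventually.of_forall hbound)

/-! ### Expansions at infinity and part (ii). -/

lemma isBigO_add_const_cobounded (a : ℂ) :
    (fun s : ℂ => s) =O[Bornology.cobounded ℂ] fun s => s + a := by
  refine IsBigO.of_bound 2 ?_
  filter_upwards [tendsto_norm_cobounded_atTop.eventually_ge_atTop (2 * ‖a‖)] with s hs
  have : ‖s‖ ≤ ‖s + a‖ + ‖a‖ := by simpa using norm_sub_le (s + a) a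
  linarith

lemma eventually_add_const_ne_zero (a : ℂ) : ∀ᶠ s : ℂ in Bornology.cobounded ℂ, s + a ≠ 0 := by
  filter_upwards [tendsto_norm_cobounded_atTop.eventually_gt_atTop ‖a‖] with s hs h
  rw [eq_neg_of_add_eq_zero_left h, norm_neg] at hs
  exact lt_irrefl _ hs

lemma one_div_add_const_isBigO (a : ℂ) :
    (fun s : ℂ => 1 / (s + a)) =O[Bornology.cobounded ℂ] fun s => 1 / s := by
  simp only [one_div]
  refine (isBigO_add_const_cobounded a).inv_rev ?_
  filter_upwards [eventually_add_const_ne_zero 0] with s hs h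
  simp [h] at hs

lemma one_div_add_const_sub_isBigO (a : ℂ) :
    (fun s : ℂ => 1 / (s + a) - 1 / s) =O[Bornology.cobounded ℂ] fun s => 1 / s ^ 2 := by
  have h := (((one_div_add_const_isBigO a).mul (isBigO_refl (fun s : ℂ => 1 / s) _)).const_mul_left
    (-a))
  refine h.congr' ?_ (Eventually.of_forall fun s => by ring)
  filter_upwards [eventually_add_const_ne_zero a, eventually_add_const_ne_zero 0] with s h1 h2
  rw [add_zero] at h2
  field_simp
  ring

lemma poleSum_sub_isBigO {N : ℕ} (c : Fin (N + 1) → ℂ) :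
    (fun s : ℂ => poleSum c s - (c 0 + (∑ n : Fin N, c n.succ) / s)) =O[Bornology.cobounded ℂ]
      fun s => 1 / s ^ 2 := by
  have h : (fun s : ℂ => ∑ n : Fin N, c n.succ * (1 / (s + (n : ℕ)) - 1 / s))
      =O[Bornology.cobounded ℂ] fun s => 1 / s ^ 2 :=
    IsBigO.fun_sum fun n _ => (one_div_add_const_sub_isBigO _).const_mul_left _
  refine h.congr_left fun s => ?_
  rw [poleSum, Finset.sum_div, add_sub_add_left_eq_sub, ← Finset.sum_sub_distrib]
  exact Finset.sum_congr rfl fun n _ => by ring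

lemma scaledGamma_sub_isBigO (r : ℝ) :
    (fun s : ℂ => scaledGamma r s / (√(2 * Real.pi) : ℝ) - (1 + stirlingCoeff r / s))
      =O[atInfinity r] fun s => 1 / s ^ 2 := by
  obtain ⟨B, R, h⟩ := exists_norm_scaledGamma_sub_le r
  have h1 : (fun s : ℂ => scaledGamma r s / (√(2 * Real.pi) : ℝ) -
      (1 + stirlingCoeff r / (s + r))) =O[atInfinity r] fun s => (1 / (s + r)) ^ 2 := by
    refine IsBigO.of_bound B ?_
    have hR : ∀ᶠ s : ℂ in atInfinity r, R + |r| ≤ ‖s‖ :=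
      (tendsto_norm_cobounded_atTop.eventually_ge_atTop _).filter_mono inf_le_left
    have hre : ∀ᶠ s : ℂ in atInfinity r, 0 < (s + r).re :=
      eventually_of_mem (mem_inf_of_right (mem_principal_self _)) fun _ hs => hs
    filter_upwards [hR, hre] with s hs hs'
    have h2 : ‖s‖ ≤ ‖s + r‖ + |r| := by simpa using norm_sub_le (s + r) (r : ℂ)
    have := h s (by linarith) hs'
    rwa [norm_pow, norm_div, norm_one, div_pow, one_pow, mul_one_div]
  have h2 : (fun s : ℂ => (1 / (s + r)) ^ 2) =O[atInfinity r] fun s => 1 / s ^ 2 := by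
    exact (((one_div_add_const_isBigO (r : ℂ)).mono inf_le_left).pow 2).congr_right fun s => by
      rw [div_pow, one_pow]
  have h3 : (fun s : ℂ => stirlingCoeff r * (1 / (s + r) - 1 / s)) =O[atInfinity r]
      fun s => 1 / s ^ 2 :=
    ((one_div_add_const_sub_isBigO (r : ℂ)).mono inf_le_left).const_mul_left _
  refine ((h1.trans h2).add h3).congr_left fun s => ?_
  ring

lemma relError_eq {N : ℕ} (r : ℝ) (c : Fin (N + 1) → ℂ) (s : ℂ) :
    relError r c s = 1 - poleSum c s / scaledGamma r s := by
  rw [relError, gammaN, scaledGamma, Complex.exp_neg]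
  simp only [div_eq_mul_inv, mul_inv, inv_inv]
  ring

lemma tendsto_one_div_atInfinity (r : ℝ) :
    Tendsto (fun s : ℂ => 1 / s) (atInfinity r) (𝓝 0) := by
  simp only [one_div]
  exact tendsto_inv₀_cobounded.mono_left inf_le_left

lemma one_div_sq_isBigO_atInfinity (r : ℝ) :
    (fun s : ℂ => 1 / s ^ 2) =O[atInfinity r] fun s => 1 / s := by
  refine ((isBigO_refl (fun s : ℂ => 1 / s) (atInfinity r)).mul
    ((tendsto_one_div_atInfinity r).isBigO_one ℂ)).congr (fun s => by ring) fun s => by ring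

lemma isBigO_one_div_of_sub {r : ℝ} {f : ℂ → ℂ} {a b : ℂ}
    (hf : (fun s => f s - (a + b / s)) =O[atInfinity r] fun s => 1 / s ^ 2) :
    (fun s => f s - a) =O[atInfinity r] fun s => 1 / s := by
  refine ((hf.trans (one_div_sq_isBigO_atInfinity r)).add
    ((isBigO_refl (fun s : ℂ => 1 / s) (atInfinity r)).const_mul_left b)).congr_left fun s => ?_
  ring

lemma tendsto_of_sub_isBigO {r : ℝ} {f : ℂ → ℂ} {a b : ℂ}
    (hf : (fun s => f s - (a + b / s)) =O[atInfinity r] fun s => 1 / s ^ 2) :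
    Tendsto f (atInfinity r) (𝓝 a) :=
  tendsto_sub_nhds_zero_iff.1
    ((isBigO_one_div_of_sub hf).trans_tendsto (tendsto_one_div_atInfinity r))

lemma inv_sub_isBigO {r : ℝ} {G : ℂ → ℂ} {b : ℂ}
    (hG : (fun s => G s - (1 + b / s)) =O[atInfinity r] fun s => 1 / s ^ 2) :
    (fun s => (G s)⁻¹ - (1 - b / s)) =O[atInfinity r] fun s => 1 / s ^ 2 := by
  have hlim := tendsto_of_sub_isBigO hG
  have h1 : (fun s => (G s)⁻¹) =O[atInfinity r] fun _ => (1 : ℂ) :=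
    (hlim.inv₀ one_ne_zero).isBigO_one ℂ
  have h2 : (fun s : ℂ => 1 - b * (1 / s)) =O[atInfinity r] fun _ => (1 : ℂ) :=
    (tendsto_const_nhds.sub ((tendsto_one_div_atInfinity r).const_mul b)).isBigO_one ℂ
  -- This is 1 - G(1 - b/s), that is, G times the quantity to be bounded.
  have h3 : (fun s : ℂ => b ^ 2 * (1 / s ^ 2) - (G s - (1 + b / s)) * (1 - b * (1 / s)))
      =O[atInfinity r] fun s => 1 / s ^ 2 := by
    refine ((isBigO_refl _ _).const_mul_left _).sub ?_
    simpa using hG.mul h2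
  have h4 := h3.mul h1
  refine h4.congr' ?_ (Eventually.of_forall fun s => by simp)
  filter_upwards [hlim.eventually_ne one_ne_zero] with s hs
  field_simp
  ring

theorem exists_relError_expansion {N : ℕ} (r : ℝ) (c : Fin (N + 1) → ℂ) :
    ∃ D : ℂ, (fun s : ℂ => relError r c s -
      ((1 - c 0 / (Real.sqrt (2 * Real.pi) : ℂ)) + D / s)) =O[atInfinity r]
        fun s : ℂ => 1 / s ^ 2 := by
  set w : ℂ := ((√(2 * Real.pi) : ℝ) : ℂ)
  set T : ℂ := ∑ n : Fin N, c n.succ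
  set κ := stirlingCoeff r
  have hP := (poleSum_sub_isBigO c).mono (inf_le_left : atInfinity r ≤ _)
  have hG := inv_sub_isBigO (scaledGamma_sub_isBigO r)
  have h1 := (((tendsto_of_sub_isBigO hP).isBigO_one ℂ).mul hG).congr_right
    (g₂ := fun s => 1 / s ^ 2) fun s => one_mul _
  have h2 := (((isBigO_refl (fun s : ℂ => 1 / s) (atInfinity r)).mul
    (isBigO_one_div_of_sub hP)).const_mul_left κ).congr_right
    (g₂ := fun s => 1 / s ^ 2) fun s => by ring
  refine ⟨-(T - κ * c 0) / w, (((h1.add hP).sub h2).const_mul_left (-w⁻¹)).congr_left fun s => ?_⟩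
  have e : poleSum c s / scaledGamma r s = w⁻¹ * (poleSum c s * (scaledGamma r s / w)⁻¹) := by
    have hw : w ≠ 0 := by
      have : 0 < √(2 * Real.pi) := by positivity
      exact Complex.ofReal_ne_zero.2 this.ne'
    rw [inv_div, div_eq_mul_inv, div_eq_mul_inv]
    field_simp
  rw [relError_eq, e]
  ring

/-! ### Comparing the cleared error with (1 - ws)ψ. -/

/-- The polynomial `φ · F_N`. -/
def phiMulPoleSum {N : ℕ} (c : Fin (N + 1) → ℂ) (s : ℂ) : ℂ :=
  c 0 * phi N s + ∑ n : Fin N, c n.succ * ∏ j ∈ (Finset.range N).erase n, (s + (j : ℕ))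

lemma phiMulPoleSum_eq {N : ℕ} (c : Fin (N + 1) → ℂ) {s : ℂ} (hs : ∀ n : ℕ, s ≠ -(n : ℂ)) :
    phiMulPoleSum c s = poleSum c s * phi N s := by
  rw [phiMulPoleSum, poleSum, add_mul, Finset.sum_mul]
  congr 1
  refine Finset.sum_congr rfl fun n _ => ?_
  have hn : s + (n : ℕ) ≠ 0 := fun h => hs n (eq_neg_of_add_eq_zero_left h)
  rw [phi, ← Finset.mul_prod_erase _ _ (Finset.mem_range.2 n.2)]
  field_simp

/-- The function `s φ(s) (1 - Γ_N(s; r) / Γ(s))`, extended analytically across the zeros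
of `φ`. -/
def clearedError {N : ℕ} (r : ℝ) (c : Fin (N + 1) → ℂ) (s : ℂ) : ℂ :=
  s * (phi N s - (s + r) ^ (s - 1 / 2) * Complex.exp (-(s + r)) * phiMulPoleSum c s *
    (Complex.Gamma s)⁻¹)

lemma clearedError_eq {N : ℕ} (r : ℝ) (c : Fin (N + 1) → ℂ) {s : ℂ}
    (hs : ∀ n : ℕ, s ≠ -(n : ℂ)) :
    clearedError r c s = relError r c s * (s * phi N s) := by
  rw [clearedError, phiMulPoleSum_eq c hs, relError, gammaN, div_eq_mul_inv]
  ring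

lemma differentiableAt_clearedError {N : ℕ} {r : ℝ} (c : Fin (N + 1) → ℂ) {p : ℂ}
    (hp : 0 < (p + r).re) : DifferentiableAt ℂ (clearedError r c) p := by
  have h1 : DifferentiableAt ℂ (fun s : ℂ => (s + r) ^ (s - 1 / 2)) p :=
    DifferentiableAt.cpow (by fun_prop) (by fun_prop) (Or.inl hp)
  have h2 : DifferentiableAt ℂ (fun s : ℂ => (Complex.Gamma s)⁻¹) p :=
    Complex.differentiable_one_div_Gamma p
  have h3 : Differentiable ℂ (phi N) := by unfold phi; fun_prop
  have h4 : Differentiable ℂ (phiMulPoleSum c) := by unfold phiMulPoleSum; fun_prop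
  unfold clearedError
  fun_prop

lemma isBigO_sub_mul_of_eq_zero {H g : ℂ → ℂ} {p : ℂ} (hH : DifferentiableAt ℂ H p)
    (h0 : H p = 0) (hg : ContinuousAt g p) (hg0 : g p ≠ 0) :
    H =O[𝓝 p] fun s => (s - p) * g s := by
  have h1 : H =O[𝓝 p] fun s => s - p := by simpa [h0] using hH.isBigO_sub
  have h2 : (fun _ => (1 : ℂ)) =O[𝓝 p] g :=
    (isBigO_const_left_iff_pos_le_norm one_ne_zero).2
      ⟨‖g p‖ / 2, by positivity,
        hg.norm.eventually_const_le (half_lt_self (norm_pos_iff.2 hg0))⟩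
  simpa using h1.mul h2

/-- `hwz` and the injectivity of z make all zeros of (1 - ws)ψ simple. Taking w = 0 encodes z̄ = ∞.
-/
lemma clearedError_isBigO_nhds {N : ℕ} {r : ℝ} {c : Fin (N + 1) → ℂ} {z : Fin (N + 1) → ℂ} {w : ℂ}
    (hz : Function.Injective z) (hz0 : ∀ k, clearedError r c (z k) = 0)
    (hwz : ∀ k, 1 - w * z k ≠ 0)
    (hw0 : ∀ p, 1 - w * p = 0 → clearedError r c p = 0) {p : ℂ} (hp : 0 < (p + r).re) :
    clearedError r c =O[𝓝 p] fun s => (1 - w * s) * psi z s := by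
  have hH := differentiableAt_clearedError c hp
  have hpsi : Continuous (psi z) := by unfold psi; fun_prop
  by_cases hzp : ∃ k, p = z k
  · obtain ⟨k, rfl⟩ := hzp
    have := isBigO_sub_mul_of_eq_zero (p := z k)
      (g := fun s => (1 - w * s) * ∏ j ∈ Finset.univ.erase k, (s - z j)) hH (hz0 k)
      (Continuous.continuousAt (by fun_prop))
      (mul_ne_zero (hwz k) (Finset.prod_ne_zero_iff.2 fun j hj =>
        sub_ne_zero.2 (hz.ne (Finset.ne_of_mem_erase hj).symm)))
    refine this.congr_right fun s => ?_
    rw [psi, ← Finset.mul_prod_erase _ _ (Finset.mem_univ k)]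
    ring
  have hpsi0 : psi z p ≠ 0 :=
    Finset.prod_ne_zero_iff.2 fun k _ => sub_ne_zero.2 fun h => hzp ⟨k, h⟩
  by_cases hwp : 1 - w * p = 0
  · have hwne : w ≠ 0 := by rintro rfl; simp at hwp
    have := isBigO_sub_mul_of_eq_zero (p := p) (g := fun s => -w * psi z s) hH (hw0 p hwp)
      (Continuous.continuousAt (by fun_prop)) (mul_ne_zero (neg_ne_zero.2 hwne) hpsi0)
    refine this.congr_right fun s => ?_
    linear_combination -psi z s * hwp
  · have hc : Continuous fun s => (1 - w * s) * psi z s := by fun_prop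
    refine (hH.continuousAt.isBigO_one ℂ).trans
      ((isBigO_const_left_iff_pos_le_norm one_ne_zero).2 ⟨‖(1 - w * p) * psi z p‖ / 2, ?_, ?_⟩)
    · have := mul_ne_zero hwp hpsi0
      positivity
    · exact hc.continuousAt.norm.eventually_const_le
        (half_lt_self (norm_pos_iff.2 (mul_ne_zero hwp hpsi0)))

lemma one_isBigO_one_sub_mul (w : ℂ) :
    (fun _ => (1 : ℂ)) =O[Bornology.cobounded ℂ] fun s => 1 - w * s := by
  rcases eq_or_ne w 0 with rfl | hw
  · simpa using isBigO_refl (fun _ : ℂ => (1 : ℂ)) _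
  have h1 : (fun _ : ℂ => (1 : ℂ)) =O[Bornology.cobounded ℂ] fun s => s :=
    (isBigO_const_left_iff_pos_le_norm one_ne_zero).2
      ⟨1, one_pos, tendsto_norm_cobounded_atTop.eventually_ge_atTop 1⟩
  refine (h1.trans (isBigO_add_const_cobounded (-w⁻¹))).trans
    ((isBigO_const_mul_self (-w⁻¹) (fun s => 1 - w * s) _).congr_left fun s => ?_)
  field_simp
  ring

lemma mul_phi_isBigO_psi {N : ℕ} (z : Fin (N + 1) → ℂ) :
    (fun s => s * phi N s) =O[Bornology.cobounded ℂ] psi z := by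
  have h1 : (fun s : ℂ => s * phi N s) =O[Bornology.cobounded ℂ]
      fun s => s * ∏ _n ∈ Finset.range N, s := by
    refine (isBigO_refl (fun s : ℂ => s) _).mul (IsBigO.finsetProd fun n _ => ?_)
    have h : (fun _ : ℂ => (n : ℂ)) =O[Bornology.cobounded ℂ] fun s : ℂ => s := by
      refine ((isBigO_const_const (n : ℂ) (one_ne_zero (α := ℂ)) _)).trans ?_
      exact (isBigO_const_left_iff_pos_le_norm one_ne_zero).2
        ⟨1, one_pos, tendsto_norm_cobounded_atTop.eventually_ge_atTop 1⟩
    exact (isBigO_refl _ _).add h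
  have h2 : (fun s : ℂ => ∏ _k : Fin (N + 1), s) =O[Bornology.cobounded ℂ] psi z :=
    IsBigO.finsetProd fun k _ => by
      simpa [sub_eq_add_neg] using isBigO_add_const_cobounded (-z k)
  refine h1.trans (h2.congr_left fun s => ?_)
  simp [pow_succ']

lemma relError_isBigO_one {N : ℕ} (r : ℝ) (c : Fin (N + 1) → ℂ) :
    relError r c =O[atInfinity r] fun _ => (1 : ℂ) := by
  obtain ⟨D, hD⟩ := exists_relError_expansion r c
  exact (tendsto_of_sub_isBigO hD).isBigO_one ℂ

lemma exists_norm_clearedError_le {N : ℕ} {r : ℝ} (hr : 0 < r) {c : Fin (N + 1) → ℂ}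
    {z : Fin (N + 1) → ℂ} {w : ℂ} (hz : Function.Injective z)
    (hz0 : ∀ k, clearedError r c (z k) = 0) (hwz : ∀ k, 1 - w * z k ≠ 0)
    (hw0 : ∀ p, 1 - w * p = 0 → clearedError r c p = 0) :
    ∃ C : ℝ, ∀ s : ℂ, 0 < s.re → ‖clearedError r c s‖ ≤ C * ‖(1 - w * s) * psi z s‖ := by
  have hpole : ∀ s : ℂ, 0 < s.re → ∀ n : ℕ, s ≠ -(n : ℂ) := by
    rintro s hs n rfl
    simp at hs
    linarith [(Nat.cast_nonneg n : (0 : ℝ) ≤ n)]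
  have hinf : clearedError r c =O[Bornology.cobounded ℂ ⊓ 𝓟 {s : ℂ | 0 < s.re}]
      fun s => (1 - w * s) * psi z s := by
    have hle : Bornology.cobounded ℂ ⊓ 𝓟 {s : ℂ | 0 < s.re} ≤ atInfinity r := by
      refine inf_le_inf_left _ (principal_mono.2 fun s hs => ?_)
      have hs' : 0 < s.re := hs
      simp only [Set.mem_ofPred_eq, Complex.add_re, Complex.ofReal_re]
      linarith
    have h1 := (((relError_isBigO_one r c).mono hle).trans
      ((one_isBigO_one_sub_mul w).mono inf_le_left)).mul
      ((mul_phi_isBigO_psi z).mono inf_le_left)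
    refine h1.congr' ?_ EventuallyEq.rfl
    filter_upwards [mem_inf_of_right (mem_principal_self _)] with s hs
    exact (clearedError_eq r c (hpole s hs)).symm
  obtain ⟨C₁, hC₁⟩ := hinf.bound
  rw [eventually_inf_principal] at hC₁
  obtain ⟨R, -, hR⟩ := (hasBasis_cobounded_norm (E := ℂ)).eventually_iff.1 hC₁
  -- Compactness requires including the line Re s = 0; r > 0 keeps H analytic there, even at the
  -- pole s = 0 of Γ.
  have hcpt : IsCompact (Metric.closedBall (0 : ℂ) R ∩ {s : ℂ | 0 ≤ s.re}) :=
    (isCompact_closedBall 0 R).inter_right (isClosed_le continuous_const Complex.continuous_re)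
  obtain ⟨C₂, hC₂⟩ : ∃ C : ℝ, ∀ s ∈ Metric.closedBall (0 : ℂ) R ∩ {s : ℂ | 0 ≤ s.re},
      ‖clearedError r c s‖ ≤ C * ‖(1 - w * s) * psi z s‖ := by
    refine hcpt.induction_on (p := fun S => ∃ C : ℝ, ∀ s ∈ S,
      ‖clearedError r c s‖ ≤ C * ‖(1 - w * s) * psi z s‖) ⟨0, by simp⟩ ?_ ?_ ?_
    · rintro S T hST ⟨C, hC⟩
      exact ⟨C, fun s hs => hC s (hST hs)⟩
    · rintro S T ⟨C, hC⟩ ⟨C', hC'⟩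
      refine ⟨max C C', fun s hs => ?_⟩
      rcases hs with hs | hs
      · exact (hC s hs).trans (by gcongr; exact le_max_left _ _)
      · exact (hC' s hs).trans (by gcongr; exact le_max_right _ _)
    · intro p hp
      have hp' : 0 < (p + r).re := by
        have : 0 ≤ p.re := hp.2
        simp only [Complex.add_re, Complex.ofReal_re]
        linarith
      obtain ⟨C, hC⟩ := (clearedError_isBigO_nhds hz hz0 hwz hw0 hp').bound
      exact ⟨_, mem_nhdsWithin_of_mem_nhds hC, C, fun s hs => hs⟩
  refine ⟨max C₁ C₂, fun s hs => ?_⟩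
  rcases le_total R ‖s‖ with h | h
  · exact (hR h hs).trans (by gcongr; exact le_max_left _ _)
  · exact (hC₂ s ⟨by simpa using h, hs.le⟩).trans (by gcongr; exact le_max_right _ _)

/-! ### Exactness at the nodes and conclusion. -/

lemma relError_eq_zero_of_eq {N : ℕ} {r : ℝ} {c : Fin (N + 1) → ℂ} {s : ℂ}
    (hpole : ∀ n : ℕ, s ≠ -(n : ℂ)) (h : gammaN r c s = Complex.Gamma s) : relError r c s = 0 := by
  rw [relError, h, div_self (Complex.Gamma_ne_zero hpole), sub_self]

lemma relError_node_eq_zero {N : ℕ} {r : ℝ} {z c : Fin (N + 1) → ℂ}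
    (hc : (poleMatrix z).mulVec c = fun k => scaledGamma r (z k)) {k : Fin (N + 1)}
    (hre : 0 < (z k + r).re) (hpole : ∀ n : ℕ, z k ≠ -(n : ℂ)) : relError r c (z k) = 0 := by
  have h1 : poleSum c (z k) = scaledGamma r (z k) := by
    rw [← congrFun hc k, Matrix.mulVec, dotProduct, Fin.sum_univ_succ, poleSum]
    simp [poleMatrix, div_eq_inv_mul]
  have hu0 : z k + r ≠ 0 := by intro h; rw [h] at hre; simp at hre
  have h2 : scaledGamma r (z k) ≠ 0 :=
    div_ne_zero (mul_ne_zero (Complex.Gamma_ne_zero hpole) (Complex.exp_ne_zero _))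
      (by simp [Complex.cpow_eq_zero_iff, hu0])
  rw [relError_eq, h1, div_self h2, sub_self]

end GammaApprox

end

theorem theorem2 (N : ℕ) (hN : 1 ≤ N) (r : ℝ) (hr : (N : ℝ) - 1 < r)
    (z : Fin (N + 1) → ℂ) (hz_inj : Function.Injective z)
    (hz_re : ∀ k, 0 < (z k + r).re) (hz_pole : ∀ k, ∀ n : ℕ, z k ≠ -(n : ℂ))
    (c : Fin (N + 1) → ℂ)
    (hc : (GammaApprox.poleMatrix z).mulVec c = fun k => GammaApprox.scaledGamma r (z k)) :
    (∀ zbar : OnePoint ℂ, (∀ k, zbar ≠ (z k : OnePoint ℂ)) → GammaApprox.IsExactAt r c zbar →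
      ∃ C : ℝ, ∀ s : ℂ, 0 < s.re →
        ‖GammaApprox.relError r c s‖ ≤
          C * ‖(1 / s - GammaApprox.recip zbar) *
            (GammaApprox.psi z s / GammaApprox.phi N s)‖) ∧
    (∃ D : ℂ,
      (fun s : ℂ => GammaApprox.relError r c s -
          ((1 - c 0 / (Real.sqrt (2 * Real.pi) : ℂ)) + D / s))
        =O[GammaApprox.atInfinity r] fun s : ℂ => 1 / s ^ 2) := by
  open GammaApprox in
  refine ⟨fun zbar hzbar hexact => ?_, exists_relError_expansion r c⟩
  have hr0 : 0 < r := by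
    have : (1 : ℝ) ≤ N := by exact_mod_cast hN
    linarith
  have hnode : ∀ k, clearedError r c (z k) = 0 := fun k => by
    rw [clearedError_eq r c (hz_pole k), relError_node_eq_zero hc (hz_re k) (hz_pole k), zero_mul]
  obtain ⟨hwz, hw0⟩ : (∀ k, 1 - recip zbar * z k ≠ 0) ∧
      ∀ p, 1 - recip zbar * p = 0 → clearedError r c p = 0 := by
    induction zbar using OnePoint.rec with
    -- Here 1 - ws is the constant 1 and has no zeros.
    | infty => simp [recip]
    | coe t =>
      obtain ⟨-, hpole, heq⟩ :
        0 < (t + r).re ∧ (∀ n : ℕ, t ≠ -(n : ℂ)) ∧ gammaN r c t = Complex.Gamma t := hexact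
      have ht0 : t ≠ 0 := by simpa using hpole 0
      have hrecip : recip (t : OnePoint ℂ) = 1 / t := rfl
      have key : ∀ p : ℂ, 1 - recip (t : OnePoint ℂ) * p = 0 → p = t := by
        intro p hp
        rw [hrecip] at hp
        field_simp at hp
        linear_combination -hp
      refine ⟨fun k hk => hzbar k (by rw [key _ hk]), fun p hp => ?_⟩
      rw [key p hp, clearedError_eq r c hpole, relError_eq_zero_of_eq hpole heq, zero_mul]
  obtain ⟨C, hC⟩ := exists_norm_clearedError_le hr0 hz_inj hnode hwz hw0
  refine ⟨C, fun s hs => ?_⟩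
  have hpole : ∀ n : ℕ, s ≠ -(n : ℂ) := by
    rintro n rfl
    simp at hs
    linarith [(Nat.cast_nonneg n : (0 : ℝ) ≤ n)]
  have hs0 : s ≠ 0 := by simpa using hpole 0
  have hphi : phi N s ≠ 0 :=
    Finset.prod_ne_zero_iff.2 fun n _ h => hpole n (eq_neg_of_add_eq_zero_left h)
  have hpos : 0 < ‖s * phi N s‖ := norm_pos_iff.2 (mul_ne_zero hs0 hphi)
  have e : (1 - recip zbar * s) * psi z s =
      (1 / s - recip zbar) * (psi z s / phi N s) * (s * phi N s) := by
    field_simp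
  have h := hC s hs
  rw [clearedError_eq r c hpole, e, norm_mul, norm_mul _ (s * phi N s), ← mul_assoc] at h
  exact le_of_mul_le_mul_right h hpos
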